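/- Let $H_1,H_2$ be complex separable Hilbert spaces, let $H_1\otimes H_2$ be their Hilbert tensor product (the completion of the algebraic tensor product for the inner product with $\langle\phi\otimes\psi,\phi'\otimes\psi'\rangle=\langle\phi,\phi'\rangle\langle\psi,\psi'\rangle$), and let $A,B$ be bounded operators on $H_1$ and $H_2$. Let $A\otimes B$ be the bounded operator on $H_1\otimes H_2$ with $(A\otimes B)(\phi\otimes\psi)=A\phi\otimes B\psi$. For $0<p<\infty$, the Schatten–von Neumann class $S_p(H)$ consists of the compact operators $T$ on $H$ with $\sum_n s_n(T)^p<\infty$, where the singular values $s_n(T)$ are the eigenvalues of $|T|=\sqrt{T^*T}$ counted with multiplicity, and $\|T\|_p=\bigl(\sum_n s_n(T)^p\bigr)^{1/p}$. For $T\in S_1(H)$ put $\mathrm{Tr}(T)=\sum_k\langle\phi_k,T\phi_k\rangle$, where $(\phi_k)_k$ is any orthonormal basis of $H$. 1. If $A$ and $B$ are compact, then $A\otimes B$ is compact. 2. Let $0<p<\infty$. If $A\in S_p(H_1)$ and $B\in S_p(H_2)$, then $A\otimes B\in S_p(H_1\otimes H_2)$ and $\|A\otimes B\|_p=\|A\|_p\,\|B\|_p$.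 3. If $A\in S_1(H_1)$ and $B\in S_1(H_2)$, then the series defining $\mathrm{Tr}(A)$, $\mathrm{Tr}(B)$ and $\mathrm{Tr}(A\otimes B)$ converge absolutely, with sums independent of the choice of the orthonormal basis, and $\mathrm{Tr}(A\otimes B)=\mathrm{Tr}(A)\,\mathrm{Tr}(B)$. -/

import Mathlib

open scoped TensorProduct InnerProductSpace

noncomputable section

namespace SchattenTensor

/-- The Hilbert tensor product: the completion of the algebraic tensor product with respect to the
inner product determined by `⟪φ ⊗ ψ, φ' ⊗ ψ'⟫ = ⟪φ, φ'⟫ * ⟪ψ, ψ'⟫`. -/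
abbrev HilbertTensor (H₁ : Type*) (H₂ : Type*)
    [NormedAddCommGroup H₁] [InnerProductSpace ℂ H₁]
    [NormedAddCommGroup H₂] [InnerProductSpace ℂ H₂] : Type _ :=
  UniformSpace.Completion (H₁ ⊗[ℂ] H₂)

/-- The elementary tensor `φ ⊗ ψ` in the Hilbert tensor product. -/
def tmul {H₁ H₂ : Type*}
    [NormedAddCommGroup H₁] [InnerProductSpace ℂ H₁]
    [NormedAddCommGroup H₂] [InnerProductSpace ℂ H₂] (φ : H₁) (ψ : H₂) : HilbertTensor H₁ H₂ :=
  ((φ ⊗ₜ[ℂ] ψ : H₁ ⊗[ℂ] H₂) : UniformSpace.Completion (H₁ ⊗[ℂ] H₂))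

theorem inner_tmul {H₁ H₂ : Type*}
    [NormedAddCommGroup H₁] [InnerProductSpace ℂ H₁]
    [NormedAddCommGroup H₂] [InnerProductSpace ℂ H₂] (φ φ' : H₁) (ψ ψ' : H₂) :
    ⟪tmul φ ψ, tmul φ' ψ'⟫_ℂ = ⟪φ, φ'⟫_ℂ * ⟪ψ, ψ'⟫_ℂ := by
  simp [tmul]

/-- The tensor product `A ⊗ B` of two bounded operators: the continuous extension (that is, the
closure) to the Hilbert tensor product of the linear map on the algebraic tensor product given by
`φ ⊗ ψ ↦ A φ ⊗ B ψ`. -/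
def tensorOp {H₁ H₂ : Type*}
    [NormedAddCommGroup H₁] [InnerProductSpace ℂ H₁]
    [NormedAddCommGroup H₂] [InnerProductSpace ℂ H₂]
    (A : H₁ →L[ℂ] H₁) (B : H₂ →L[ℂ] H₂) : HilbertTensor H₁ H₂ →L[ℂ] HilbertTensor H₁ H₂ :=
  (TensorProduct.mapL A B).completion

theorem tensorOp_tmul {H₁ H₂ : Type*}
    [NormedAddCommGroup H₁] [InnerProductSpace ℂ H₁]
    [NormedAddCommGroup H₂] [InnerProductSpace ℂ H₂]
    (A : H₁ →L[ℂ] H₁) (B : H₂ →L[ℂ] H₂) (φ : H₁) (ψ : H₂) :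
    tensorOp A B (tmul φ ψ) = tmul (A φ) (B ψ) := by
  simp [tensorOp, tmul]

section Schatten

variable {H : Type*} [NormedAddCommGroup H] [InnerProductSpace ℂ H] [CompleteSpace H]

/-- The absolute value `|A| = √(A* A)` of a bounded operator. -/
def absOp (A : H →L[ℂ] H) : H →L[ℂ] H :=
  CFC.sqrt (ContinuousLinearMap.adjoint A ∘L A)

/-- The multiplicity of the real number `μ` as an eigenvalue of `|A|`, namely the dimension of
`ker (|A| - μ)`. It is `0` when `μ` is not an eigenvalue. For compact `A` the eigenspaces of `|A|`
for `μ > 0` are finite dimensional. -/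
def multiplicity (A : H →L[ℂ] H) (μ : ℝ) : ℕ :=
  Module.finrank ℂ (Module.End.eigenspace (absOp A : H →ₗ[ℂ] H) (μ : ℂ))

/-- An index set for the nonzero singular values of a compact operator `A`: each positive
eigenvalue `μ` of `|A|` occurs exactly as often as its multiplicity. (The eigenvalue `0` would only
add terms `0 ^ p = 0` to the sums below.) -/
abbrev SingularIndex (A : H →L[ℂ] H) : Type :=
  Σ μ : {μ : ℝ // 0 < μ}, Fin (multiplicity A μ)

/-- The family `(s_n(A))` of nonzero singular values of a compact operator `A`, i.e. the positive
eigenvalues of `|A|` with multiplicities counted. -/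
def singularValue (A : H →L[ℂ] H) (n : SingularIndex A) : ℝ :=
  n.1

/-- `A` belongs to the Schatten-von Neumann class `S_p(H)`: it is compact and
`∑ n, s_n(A) ^ p < ∞`. -/
def MemSchatten (p : ℝ) (A : H →L[ℂ] H) : Prop :=
  IsCompactOperator A ∧ Summable (fun n : SingularIndex A => singularValue A n ^ p)

/-- The Schatten (quasi-)norm `‖A‖_p = (∑ n, s_n(A) ^ p) ^ (1 / p)`. -/
def schattenNorm (p : ℝ) (A : H →L[ℂ] H) : ℝ :=
  (∑' n : SingularIndex A, singularValue A n ^ p) ^ (1 / p)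

end Schatten

/-- For every orthonormal basis `(φ_k)` of `H`, the series `∑ k, ⟪φ_k, T φ_k⟫` converges
absolutely, with sum `t`. -/
def HasTrace {H : Type*} [NormedAddCommGroup H] [InnerProductSpace ℂ H]
    (T : H →L[ℂ] H) (t : ℂ) : Prop :=
  ∀ (s : Set H) (b : HilbertBasis s ℂ H), HasSum (fun k : s => ⟪b k, T (b k)⟫_ℂ) t

/-- The trace `Tr T = ∑ k, ⟪φ_k, T φ_k⟫`, evaluated in some orthonormal basis `(φ_k)` of `H`. -/
def trace {H : Type*} [NormedAddCommGroup H] [InnerProductSpace ℂ H] [CompleteSpace H]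
    (T : H →L[ℂ] H) : ℂ :=
  ∑' k : (exists_hilbertBasis ℂ H).choose,
    ⟪(exists_hilbertBasis ℂ H).choose_spec.choose k,
      T ((exists_hilbertBasis ℂ H).choose_spec.choose k)⟫_ℂ

end SchattenTensor

end

open scoped TensorProduct InnerProductSpace

noncomputable section

namespace SchattenTensor

/-! ### Singular values read off from orthonormal eigenvectors of `A* A`. -/

section SingularSystem

variable {H : Type*} [NormedAddCommGroup H] [InnerProductSpace ℂ H] [CompleteSpace H]

/-! Everything is computed in a singular system: orthonormal eigenvectors of `A* A` with eigenvalues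
`s i ^ 2 > 0`, outside whose span `A` vanishes. The spectral theorem provides one for every compact
`A`, and counting dimensions of eigenspaces shows that any such system lists the singular values
with multiplicity. If `u` and `v` are systems for `A` and `B`, the vectors `u i ⊗ v j` form one for
`A ⊗ B` with values `s i * t j`. Hence the Schatten sums factor as products of series.

The trace equals `∑ ⟪u i, A (u i)⟫`, by exchanging an absolutely convergent double sum, and these
terms factor too. Compactness is separate: approximate both operators by finite-rank ones. -/

theorem absOp_isPositive (A : H →L[ℂ] H) : (absOp A).IsPositive :=
  (ContinuousLinearMap.nonneg_iff_isPositive _).1 (CFC.sqrt_nonneg _)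

theorem absOp_absOp_apply (A : H →L[ℂ] H) (x : H) :
    absOp A (absOp A x) = ContinuousLinearMap.adjoint A (A x) := by
  have h : absOp A * absOp A = ContinuousLinearMap.adjoint A ∘L A :=
    CFC.sqrt_mul_sqrt_self _ ((ContinuousLinearMap.nonneg_iff_isPositive _).2
      (ContinuousLinearMap.isPositive_adjoint_comp_self A))
  exact DFunLike.congr_fun h x

/-- Positive eigenvalues of `|A|` are the square roots of the eigenvalues of `A* A`, with the same
eigenvectors. -/
theorem absOp_apply_eq_smul_iff (A : H →L[ℂ] H) {μ : ℝ} (hμ : 0 < μ) (x : H) :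
    absOp A x = (μ : ℂ) • x ↔ ContinuousLinearMap.adjoint A (A x) = ((μ : ℂ) ^ 2) • x := by
  rw [← absOp_absOp_apply]
  constructor
  · intro h
    rw [h, map_smul, h, smul_smul, sq]
  · intro h
    -- The defect `y` satisfies `|A| y = -μ y`, so positivity of `|A|` and `μ > 0` force `y = 0`.
    obtain ⟨y, hy⟩ : ∃ y, y = absOp A x - (μ : ℂ) • x := ⟨_, rfl⟩
    have h1 : absOp A y = -((μ : ℂ) • y) := by
      rw [hy, map_sub, map_smul, h, smul_sub, smul_smul, sq]
      abel
    have h2 := (absOp_isPositive A).re_inner_nonneg_right y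
    rw [h1, inner_neg_right, inner_smul_right, map_neg, RCLike.re_to_complex,
      Complex.re_ofReal_mul, ← RCLike.re_to_complex, inner_self_eq_norm_sq] at h2
    have h4 : ‖y‖ ^ 2 = 0 := by
      have := sq_nonneg ‖y‖
      nlinarith
    exact sub_eq_zero.1 (hy ▸ norm_eq_zero.1 (pow_eq_zero_iff two_ne_zero |>.1 h4))

theorem mem_eigenspace_absOp_iff (A : H →L[ℂ] H) {μ : ℝ} (hμ : 0 < μ) (x : H) :
    x ∈ Module.End.eigenspace (absOp A : H →ₗ[ℂ] H) (μ : ℂ) ↔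
      ContinuousLinearMap.adjoint A (A x) = ((μ : ℂ) ^ 2) • x := by
  rw [Module.End.mem_eigenspace_iff, ← absOp_apply_eq_smul_iff A hμ]
  rfl

theorem isCompactOperator_adjoint_comp_self {A : H →L[ℂ] H} (hA : IsCompactOperator A) :
    IsCompactOperator (ContinuousLinearMap.adjoint A ∘L A) :=
  hA.clm_comp (ContinuousLinearMap.adjoint A)

theorem finiteDimensional_eigenspace_absOp {A : H →L[ℂ] H} (hA : IsCompactOperator A) {μ : ℝ}
    (hμ : 0 < μ) :
    FiniteDimensional ℂ (Module.End.eigenspace (absOp A : H →ₗ[ℂ] H) (μ : ℂ)) := by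
  have hμ' : ((μ : ℂ) ^ 2) ≠ 0 := by simpa using hμ.ne'
  have := ContinuousLinearMap.finite_dimensional_eigenspace
    (isCompactOperator_adjoint_comp_self hA) ((μ : ℂ) ^ 2) hμ'
  refine Submodule.finiteDimensional_of_le (S₂ := Module.End.eigenspace
    (ContinuousLinearMap.adjoint A ∘L A).toLinearMap ((μ : ℂ) ^ 2)) fun x hx => ?_
  rw [Module.End.mem_eigenspace_iff]
  exact (mem_eigenspace_absOp_iff A hμ x).1 hx

/-- An orthonormal family `u` of eigenvectors of `A* A` with eigenvalues `s i ^ 2 > 0` whose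
orthogonal complement is annihilated by `A`. -/
structure IsSingularSystem {ι : Type*} (A : H →L[ℂ] H) (u : ι → H) (s : ι → ℝ) : Prop where
  orthonormal : Orthonormal ℂ u
  pos : ∀ i, 0 < s i
  adjoint_apply : ∀ i, ContinuousLinearMap.adjoint A (A (u i)) = ((s i : ℂ) ^ 2) • u i
  apply_eq_zero : ∀ x, (∀ i, ⟪u i, x⟫_ℂ = 0) → A x = 0

theorem apply_eq_zero_of_adjoint_apply_eq_zero {A : H →L[ℂ] H} {x : H}
    (h : ContinuousLinearMap.adjoint A (A x) = 0) : A x = 0 := by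
  rw [← inner_self_eq_zero (𝕜 := ℂ), ← ContinuousLinearMap.adjoint_inner_right, h,
    inner_zero_right]

/-- Orthonormal bases of the eigenspaces of `|A|` form a singular system. -/
theorem exists_isSingularSystem {A : H →L[ℂ] H} (hA : IsCompactOperator A) :
    ∃ u : SingularIndex A → H, IsSingularSystem A u (singularValue A) := by
  have hfd : ∀ μ : {μ : ℝ // 0 < μ}, FiniteDimensional ℂ
      (Module.End.eigenspace (absOp A : H →ₗ[ℂ] H) ((μ : ℝ) : ℂ)) :=
    fun μ => finiteDimensional_eigenspace_absOp hA μ.2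
  let b := fun μ : {μ : ℝ // 0 < μ} =>
    stdOrthonormalBasis ℂ (Module.End.eigenspace (absOp A : H →ₗ[ℂ] H) ((μ : ℝ) : ℂ))
  have hort : OrthogonalFamily ℂ (fun μ : {μ : ℝ // 0 < μ} =>
      Module.End.eigenspace (absOp A : H →ₗ[ℂ] H) ((μ : ℝ) : ℂ))
      fun μ => (Module.End.eigenspace (absOp A : H →ₗ[ℂ] H) ((μ : ℝ) : ℂ)).subtypeₗᵢ :=
    (LinearMap.IsSymmetric.orthogonalFamily_eigenspaces
      (absOp_isPositive A).isSymmetric).comp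
      (γ := {μ : ℝ // 0 < μ}) (f := fun μ => ((μ : ℝ) : ℂ))
      (fun μ ν h => Subtype.ext (Complex.ofReal_injective h))
  refine ⟨fun n => (b n.1 n.2 : H), ?_, fun n => n.1.2, fun n => ?_, fun x hx => ?_⟩
  · exact hort.orthonormal_sigma_orthonormal fun μ => (b μ).orthonormal
  · exact (mem_eigenspace_absOp_iff A n.1.2 _).1 (b n.1 n.2).2
  · set S := ContinuousLinearMap.adjoint A ∘L A with hS
    have hpos : S.IsPositive := ContinuousLinearMap.isPositive_adjoint_comp_self A
    have hsym := hpos.isSymmetric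
    apply apply_eq_zero_of_adjoint_apply_eq_zero
    -- Spectral theorem for the compact self-adjoint `S`: it suffices that `S x` is orthogonal to
    -- every eigenvector `w` of `S`.
    have hbot := ContinuousLinearMap.orthogonalComplement_iSup_eigenspaces_eq_bot
      (isCompactOperator_adjoint_comp_self hA) hsym
    rw [← Submodule.mem_bot ℂ, ← hbot, ← Submodule.iInf_orthogonal]
    simp only [Submodule.mem_iInf]
    intro ν w hw
    rw [Module.End.mem_eigenspace_iff] at hw
    change S w = ν • w at hw
    have hwx : ⟪S w, x⟫_ℂ = ⟪w, S x⟫_ℂ := hsym w x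
    change ⟪w, S x⟫_ℂ = 0
    rw [← hwx, hw, inner_smul_left]
    rcases eq_or_ne w 0 with rfl | hw0
    · simp
    rcases eq_or_ne ν 0 with rfl | hν0
    · simp
    have hev : Module.End.HasEigenvalue (S : Module.End ℂ H) ν :=
      Module.End.hasEigenvalue_of_hasEigenvector
        ⟨Module.End.mem_eigenspace_iff.2 hw, hw0⟩
    obtain ⟨r, rfl⟩ : ∃ r : ℝ, (r : ℂ) = ν :=
      RCLike.conj_eq_iff_real.1 (hsym.conj_eigenvalue_eq_self hev) |>.imp fun _ h => h.symm
    have hr : 0 ≤ r := eigenvalue_nonneg_of_nonneg hev fun y => hpos.re_inner_nonneg_right y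
    have hr' : 0 < √r := Real.sqrt_pos.2 (lt_of_le_of_ne hr (by rintro rfl; simp at hν0))
    have hwm : w ∈ Module.End.eigenspace (absOp A : H →ₗ[ℂ] H) ((√r : ℝ) : ℂ) := by
      rw [mem_eigenspace_absOp_iff A hr', ← Complex.ofReal_pow, Real.sq_sqrt hr]
      exact hw
    have hsum : _ = w := congrArg Subtype.val ((b ⟨√r, hr'⟩).sum_repr ⟨w, hwm⟩)
    have hw_sum : ⟪w, x⟫_ℂ = 0 := by
      rw [← hsum]
      simp only [Submodule.coe_sum, Submodule.coe_smul, sum_inner, inner_smul_left]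
      exact Finset.sum_eq_zero fun k _ => by rw [hx ⟨⟨√r, hr'⟩, k⟩, mul_zero]
    rw [hw_sum, mul_zero]

namespace IsSingularSystem

variable {ι : Type*} {A : H →L[ℂ] H} {u : ι → H} {s : ι → ℝ}

theorem inner_eq_zero (h : IsSingularSystem A u s) {μ : ℝ} (hμ : 0 < μ) {x : H}
    (hx : ContinuousLinearMap.adjoint A (A x) = ((μ : ℂ) ^ 2) • x) {i : ι} (hi : s i ≠ μ) :
    ⟪u i, x⟫_ℂ = 0 := by
  have h1 : ⟪ContinuousLinearMap.adjoint A (A (u i)), x⟫_ℂ =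
      ⟪u i, ContinuousLinearMap.adjoint A (A x)⟫_ℂ := by
    rw [ContinuousLinearMap.adjoint_inner_left, ContinuousLinearMap.adjoint_inner_right]
  rw [h.adjoint_apply, hx, inner_smul_left, inner_smul_right, ← sub_eq_zero, ← sub_mul,
    mul_eq_zero] at h1
  refine h1.resolve_left fun h2 => hi ?_
  rw [← Complex.ofReal_pow, ← Complex.ofReal_pow, Complex.conj_ofReal, ← Complex.ofReal_sub,
    Complex.ofReal_eq_zero, sub_eq_zero] at h2
  exact (sq_eq_sq₀ (h.pos i).le hμ.le).1 h2

theorem finite_fiber (h : IsSingularSystem A u s) (hA : IsCompactOperator A)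
    (μ : {μ : ℝ // 0 < μ}) : Finite {i // s i = μ} := by
  have := finiteDimensional_eigenspace_absOp hA μ.2
  have hmem : ∀ i : {i // s i = μ},
      u i ∈ Module.End.eigenspace (absOp A : H →ₗ[ℂ] H) ((μ : ℝ) : ℂ) := fun i => by
    rw [mem_eigenspace_absOp_iff A μ.2, h.adjoint_apply, i.2]
  have hli : LinearIndependent ℂ (fun i : {i // s i = μ} =>
      (⟨u i, hmem i⟩ : Module.End.eigenspace (absOp A : H →ₗ[ℂ] H) ((μ : ℝ) : ℂ))) := by
    refine LinearIndependent.of_comp (Submodule.subtype _) ?_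
    exact (h.orthonormal.comp _ Subtype.val_injective).linearIndependent
  exact hli.finite

/-- The `u i` with `s i = μ` form an orthonormal basis of the `μ`-eigenspace of `|A|`. -/
theorem card_fiber (h : IsSingularSystem A u s) (hA : IsCompactOperator A)
    (μ : {μ : ℝ // 0 < μ}) : Nat.card {i // s i = μ} = multiplicity A μ := by
  classical
  have := h.finite_fiber hA μ
  have := Fintype.ofFinite {i // s i = μ}
  have hon : Orthonormal ℂ (fun i : {i // s i = μ} => u i) :=
    h.orthonormal.comp _ Subtype.val_injective
  have hspan : Module.End.eigenspace (absOp A : H →ₗ[ℂ] H) ((μ : ℝ) : ℂ) =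
      Submodule.span ℂ (Set.range fun i : {i // s i = μ} => u i) := by
    apply le_antisymm
    · intro x hx
      rw [mem_eigenspace_absOp_iff A μ.2] at hx
      -- With `z` the projection of `x` onto this fiber, `x - z` is orthogonal to every `u i`. So
      -- `A` kills it, and `μ² (x - z) = 0`.
      set z := ∑ i : {i // s i = μ}, ⟪u i, x⟫_ℂ • u i with hz
      have hzS : ContinuousLinearMap.adjoint A (A z) = (((μ : ℝ) : ℂ) ^ 2) • z := by
        simp only [hz, map_sum, map_smul, Finset.smul_sum]
        refine Finset.sum_congr rfl fun i _ => ?_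
        rw [h.adjoint_apply, i.2, smul_comm]
      have hxz : ContinuousLinearMap.adjoint A (A (x - z)) = (((μ : ℝ) : ℂ) ^ 2) • (x - z) := by
        rw [map_sub, map_sub, hx, hzS, smul_sub]
      have hperp : ∀ i, ⟪u i, x - z⟫_ℂ = 0 := fun i => by
        by_cases hi : s i = μ
        · rw [inner_sub_right, hz, hon.inner_right_fintype _ ⟨i, hi⟩, sub_self]
        · exact h.inner_eq_zero μ.2 hxz hi
      rw [h.apply_eq_zero _ hperp, map_zero] at hxz
      have hne : (((μ : ℝ) : ℂ) ^ 2) ≠ 0 := by simpa using μ.2.ne'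
      have hxz' : x = z := sub_eq_zero.1 ((smul_eq_zero.1 hxz.symm).resolve_left hne)
      rw [hxz']
      exact Submodule.sum_mem _ fun i _ =>
        Submodule.smul_mem _ _ (Submodule.subset_span ⟨i, rfl⟩)
    · rw [Submodule.span_le]
      rintro _ ⟨i, rfl⟩
      change u i ∈ Module.End.eigenspace (absOp A : H →ₗ[ℂ] H) ((μ : ℝ) : ℂ)
      rw [mem_eigenspace_absOp_iff A μ.2, h.adjoint_apply, i.2]
  rw [multiplicity, hspan, finrank_span_eq_card hon.linearIndependent, Nat.card_eq_fintype_card]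

/-- The values of a singular system are the singular values, with multiplicities. -/
theorem exists_equiv_singularIndex (h : IsSingularSystem A u s) (hA : IsCompactOperator A) :
    ∃ e : ι ≃ SingularIndex A, ∀ i, singularValue A (e i) = s i := by
  have hfin := h.finite_fiber hA
  let f : ι → {μ : ℝ // 0 < μ} := fun i => ⟨s i, h.pos i⟩
  have e2 : ∀ μ : {μ : ℝ // 0 < μ}, Nonempty ({i // f i = μ} ≃ Fin (multiplicity A μ)) :=
    fun μ => ⟨(Equiv.subtypeEquivRight fun i => Subtype.ext_iff).trans
      (Finite.equivFinOfCardEq (h.card_fiber hA μ))⟩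
  exact ⟨(Equiv.sigmaFiberEquiv f).symm.trans
    (Equiv.sigmaCongrRight fun μ => (e2 μ).some), fun i => rfl⟩

end IsSingularSystem

end SingularSystem

/-! ### Tensor products of operators: adjoints and compactness. -/

section Tensor

variable {H₁ H₂ : Type*}
  [NormedAddCommGroup H₁] [InnerProductSpace ℂ H₁]
  [NormedAddCommGroup H₂] [InnerProductSpace ℂ H₂]

/-- The bilinear map `(φ, ψ) ↦ φ ⊗ ψ` into the Hilbert tensor product. -/
def tmulL (H₁ H₂ : Type*)
    [NormedAddCommGroup H₁] [InnerProductSpace ℂ H₁]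
    [NormedAddCommGroup H₂] [InnerProductSpace ℂ H₂] :
    H₁ →L[ℂ] H₂ →L[ℂ] HilbertTensor H₁ H₂ :=
  (ContinuousLinearMap.compL ℂ H₂ (H₁ ⊗[ℂ] H₂) (HilbertTensor H₁ H₂)
    UniformSpace.Completion.toComplL).comp (TensorProduct.mkL ℂ H₁ H₂)

theorem smul_tmul (c : ℂ) (φ : H₁) (ψ : H₂) : tmul (c • φ) ψ = c • tmul φ ψ :=
  (tmulL H₁ H₂).map_smul₂ c φ ψ

theorem tmul_smul (c : ℂ) (φ : H₁) (ψ : H₂) : tmul φ (c • ψ) = c • tmul φ ψ :=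
  (tmulL H₁ H₂ φ).map_smul c ψ

theorem add_tmul (φ φ' : H₁) (ψ : H₂) : tmul (φ + φ') ψ = tmul φ ψ + tmul φ' ψ :=
  (tmulL H₁ H₂).map_add₂ φ φ' ψ

theorem tmul_add (φ : H₁) (ψ ψ' : H₂) : tmul φ (ψ + ψ') = tmul φ ψ + tmul φ ψ' :=
  (tmulL H₁ H₂ φ).map_add ψ ψ'

/-- Elementary tensors span a dense subspace. -/
theorem mem_of_forall_tmul_mem {V : Submodule ℂ (HilbertTensor H₁ H₂)}
    (hV : IsClosed (V : Set (HilbertTensor H₁ H₂))) (h : ∀ φ ψ, tmul φ ψ ∈ V)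
    (x : HilbertTensor H₁ H₂) : x ∈ V := by
  induction x using UniformSpace.Completion.induction_on with
  | hp => exact hV
  | ih a =>
    induction a using TensorProduct.induction_on with
    | zero =>
      rw [UniformSpace.Completion.coe_zero]
      exact V.zero_mem
    | tmul φ ψ => exact h φ ψ
    | add a b ha hb =>
      rw [UniformSpace.Completion.coe_add]
      exact V.add_mem ha hb

theorem ext_tmul {E : Type*} [NormedAddCommGroup E] [NormedSpace ℂ E]
    {S T : HilbertTensor H₁ H₂ →L[ℂ] E} (h : ∀ φ ψ, S (tmul φ ψ) = T (tmul φ ψ)) : S = T := by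
  ext1 x
  exact mem_of_forall_tmul_mem (V := LinearMap.eqLocus S.toLinearMap T.toLinearMap)
    (isClosed_eq S.continuous T.continuous) h x

theorem adjoint_tensorOp [CompleteSpace H₁] [CompleteSpace H₂]
    (A : H₁ →L[ℂ] H₁) (B : H₂ →L[ℂ] H₂) :
    ContinuousLinearMap.adjoint (tensorOp A B) =
      tensorOp (ContinuousLinearMap.adjoint A) (ContinuousLinearMap.adjoint B) := by
  refine ext_tmul fun φ ψ => ?_
  rw [← sub_eq_zero, ← innerSL_inj (𝕜 := ℂ), map_zero]
  refine ext_tmul fun φ' ψ' => ?_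
  simp [ContinuousLinearMap.adjoint_inner_left, tensorOp_tmul, inner_tmul]

theorem norm_tensorOp_le (A : H₁ →L[ℂ] H₁) (B : H₂ →L[ℂ] H₂) :
    ‖tensorOp A B‖ ≤ ‖A‖ * ‖B‖ := by
  refine ContinuousLinearMap.opNorm_le_bound _ (by positivity) fun x => ?_
  induction x using UniformSpace.Completion.induction_on with
  | hp => exact isClosed_le (by fun_prop) (by fun_prop)
  | ih a =>
    rw [tensorOp, ContinuousLinearMap.completion_apply_coe, UniformSpace.Completion.norm_coe,
      UniformSpace.Completion.norm_coe]
    exact (ContinuousLinearMap.le_opNorm _ _).trans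
      (mul_le_mul_of_nonneg_right (TensorProduct.norm_mapL_le A B) (norm_nonneg _))

/-- The bilinear map `(A, B) ↦ A ⊗ B`. -/
def tensorOpL (H₁ H₂ : Type*)
    [NormedAddCommGroup H₁] [InnerProductSpace ℂ H₁]
    [NormedAddCommGroup H₂] [InnerProductSpace ℂ H₂] :
    (H₁ →L[ℂ] H₁) →L[ℂ] (H₂ →L[ℂ] H₂) →L[ℂ] (HilbertTensor H₁ H₂ →L[ℂ] HilbertTensor H₁ H₂) :=
  LinearMap.mkContinuous₂
    (LinearMap.mk₂ ℂ tensorOp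
      (fun (A A' : H₁ →L[ℂ] H₁) (B : H₂ →L[ℂ] H₂) => ext_tmul fun φ ψ => by
        simp [tensorOp_tmul, add_tmul])
      (fun c (A : H₁ →L[ℂ] H₁) (B : H₂ →L[ℂ] H₂) => ext_tmul fun φ ψ => by
        simp [tensorOp_tmul, smul_tmul])
      (fun (A : H₁ →L[ℂ] H₁) (B B' : H₂ →L[ℂ] H₂) => ext_tmul fun φ ψ => by
        simp [tensorOp_tmul, tmul_add])
      (fun c (A : H₁ →L[ℂ] H₁) (B : H₂ →L[ℂ] H₂) => ext_tmul fun φ ψ => by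
        simp [tensorOp_tmul, tmul_smul]))
    1 fun A B => by simpa using norm_tensorOp_le A B

/-- A compact operator on a Hilbert space is a norm limit of operators of finite rank. -/
theorem mem_closure_finiteRank {H : Type*} [NormedAddCommGroup H] [InnerProductSpace ℂ H]
    {A : H →L[ℂ] H} (hA : IsCompactOperator A) :
    A ∈ closure {F : H →L[ℂ] H | FiniteDimensional ℂ F.range} := by
  rw [Metric.mem_closure_iff]
  intro ε hε
  have hK := hA.isCompact_closure_image_closedBall 1
  obtain ⟨t, -, htfin, ht⟩ := hK.totallyBounded.exists_subset (Metric.dist_mem_uniformity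
    (half_pos hε))
  -- `t` is a finite `ε/2`-net of the image of the unit ball; projecting onto its span moves each
  -- point of that image by at most `ε/2`.
  let V := Submodule.span ℂ t
  have hV : FiniteDimensional ℂ V := FiniteDimensional.span_of_finite ℂ htfin
  refine ⟨V.starProjection.comp A, ?_, ?_⟩
  · refine Submodule.finiteDimensional_of_le (S₂ := V) ?_
    rintro _ ⟨x, rfl⟩
    exact V.starProjection_apply_mem (A x)
  · rw [dist_eq_norm]
    refine lt_of_le_of_lt (ContinuousLinearMap.opNorm_le_of_unit_norm (half_pos hε).le
      fun x hx => ?_) (half_lt_self hε)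
    obtain ⟨y, hyt, hy⟩ := Set.mem_iUnion₂.1
      (ht (subset_closure ⟨x, by simp [hx], rfl⟩))
    rw [sub_apply, ContinuousLinearMap.comp_apply, V.starProjection_minimal]
    refine (ciInf_le ⟨0, ?_⟩ (⟨y, Submodule.subset_span hyt⟩ : V)).trans
      ?_
    · rintro _ ⟨z, rfl⟩
      exact norm_nonneg _
    · rw [← dist_eq_norm]
      exact le_of_lt hy

theorem isCompactOperator_of_finiteDimensional {E F : Type*} [NormedAddCommGroup E]
    [NormedSpace ℂ E] [NormedAddCommGroup F] [NormedSpace ℂ F] (T : E →L[ℂ] F)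
    (V : Submodule ℂ F) [FiniteDimensional ℂ V] (h : ∀ x, T x ∈ V) : IsCompactOperator T := by
  have := FiniteDimensional.proper ℂ V
  exact (isCompactOperator_of_locallyCompactSpace_dom (T.codRestrict V h)).clm_comp V.subtypeL

theorem isCompactOperator_tensorOp_of_finiteRank (F : H₁ →L[ℂ] H₁) (G : H₂ →L[ℂ] H₂)
    [FiniteDimensional ℂ F.range] [FiniteDimensional ℂ G.range] :
    IsCompactOperator (tensorOp F G) := by
  let V : Submodule ℂ (HilbertTensor H₁ H₂) := LinearMap.range
    ((UniformSpace.Completion.toComplL (𝕜 := ℂ) (E := H₁ ⊗[ℂ] H₂)).toLinearMap ∘ₗ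
      TensorProduct.mapIncl F.range G.range)
  -- Closedness of `V` carries the range condition from elementary tensors to the completion.
  have hV : IsClosed (V : Set (HilbertTensor H₁ H₂)) := V.closed_of_finiteDimensional
  refine isCompactOperator_of_finiteDimensional _ V
    (mem_of_forall_tmul_mem (V := V.comap (tensorOp F G).toLinearMap)
      (hV.preimage (tensorOp F G).continuous) fun φ ψ => ?_)
  refine ⟨⟨F φ, φ, rfl⟩ ⊗ₜ ⟨G ψ, ψ, rfl⟩, ?_⟩
  exact (tensorOp_tmul F G φ ψ).symm

theorem isCompactOperator_tensorOp {A : H₁ →L[ℂ] H₁} {B : H₂ →L[ℂ] H₂}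
    (hA : IsCompactOperator A) (hB : IsCompactOperator B) : IsCompactOperator (tensorOp A B) := by
  have hcl : IsClosed {T : HilbertTensor H₁ H₂ →L[ℂ] HilbertTensor H₁ H₂ | IsCompactOperator T} :=
    isClosed_setOfPred_isCompactOperator
  have hcont : Continuous (Function.uncurry (tensorOp (H₁ := H₁) (H₂ := H₂))) := by
    exact ContinuousLinearMap.continuous₂ (𝕜 := ℂ) (E := H₁ →L[ℂ] H₁) (F := H₂ →L[ℂ] H₂)
      (G := HilbertTensor H₁ H₂ →L[ℂ] HilbertTensor H₁ H₂) (tensorOpL H₁ H₂)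
  exact hcl.closure_subset (map_mem_closure₂ hcont
    (mem_closure_finiteRank hA) (mem_closure_finiteRank hB)
    fun F (hF : FiniteDimensional ℂ F.range) G (hG : FiniteDimensional ℂ G.range) =>
      isCompactOperator_tensorOp_of_finiteRank F G)

variable [CompleteSpace H₁] [CompleteSpace H₂]

/-- Since `A` kills the orthogonal complement of the `u i`, the range of `A*` lies in the double
complement, their closed span. -/
theorem IsSingularSystem.adjoint_apply_mem_closure {ι H : Type*} [NormedAddCommGroup H]
    [InnerProductSpace ℂ H] [CompleteSpace H] {A : H →L[ℂ] H} {u : ι → H} {s : ι → ℝ}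
    (h : IsSingularSystem A u s) (y : H) :
    ContinuousLinearMap.adjoint A y ∈ (Submodule.span ℂ (Set.range u)).topologicalClosure := by
  rw [← Submodule.orthogonal_orthogonal_eq_closure, Submodule.mem_orthogonal]
  intro x hx
  rw [ContinuousLinearMap.adjoint_inner_right, h.apply_eq_zero x fun i =>
    (Submodule.mem_orthogonal _ _).1 hx _ (Submodule.subset_span ⟨i, rfl⟩), inner_zero_left]

theorem IsSingularSystem.tensorOp {ι κ : Type*} {A : H₁ →L[ℂ] H₁} {B : H₂ →L[ℂ] H₂}
    {u : ι → H₁} {v : κ → H₂} {s : ι → ℝ} {t : κ → ℝ}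
    (hA : IsSingularSystem A u s) (hB : IsSingularSystem B v t) :
    IsSingularSystem (tensorOp A B) (fun n : ι × κ => tmul (u n.1) (v n.2))
      (fun n => s n.1 * t n.2) where
  orthonormal := by
    have := hA.orthonormal.tmul hB.orthonormal
    exact this.comp_linearIsometry (UniformSpace.Completion.toComplₗᵢ (𝕜 := ℂ))
  pos n := mul_pos (hA.pos _) (hB.pos _)
  adjoint_apply n := by
    rw [adjoint_tensorOp, tensorOp_tmul, tensorOp_tmul, hA.adjoint_apply, hB.adjoint_apply,
      smul_tmul, tmul_smul, smul_smul]
    push_cast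
    rw [mul_pow]
  apply_eq_zero x hx := by
    -- Orthogonality to all `u i ⊗ v j` passes to closed spans, one factor at a time. These contain
    -- `A* φ` and `B* ψ`, so `(A ⊗ B) x` is orthogonal to every `φ ⊗ ψ`.
    have key : ∀ φ' ∈ (Submodule.span ℂ (Set.range u)).topologicalClosure,
        ∀ ψ' ∈ (Submodule.span ℂ (Set.range v)).topologicalClosure,
        ⟪x, tmul φ' ψ'⟫_ℂ = 0 := by
      have h1 : ∀ φ' ∈ (Submodule.span ℂ (Set.range u)).topologicalClosure,
          ∀ j, ⟪x, tmul φ' (v j)⟫_ℂ = 0 := by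
        intro φ' hφ' j
        let L : H₁ →L[ℂ] ℂ := (innerSL ℂ x).comp ((tmulL H₁ H₂).flip (v j))
        have : (Submodule.span ℂ (Set.range u)).topologicalClosure ≤ L.ker :=
          Submodule.topologicalClosure_minimal _ (Submodule.span_le.2 (by
            rintro _ ⟨i, rfl⟩
            exact inner_eq_zero_symm.1 (hx (i, j)))) L.isClosed_ker
        exact this hφ'
      intro φ' hφ' ψ' hψ'
      let L : H₂ →L[ℂ] ℂ := (innerSL ℂ x).comp (tmulL H₁ H₂ φ')
      have : (Submodule.span ℂ (Set.range v)).topologicalClosure ≤ L.ker :=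
        Submodule.topologicalClosure_minimal _ (Submodule.span_le.2 (by
          rintro _ ⟨j, rfl⟩
          exact h1 φ' hφ' j)) L.isClosed_ker
      exact this hψ'
    rw [← innerSL_inj (𝕜 := ℂ), map_zero]
    refine ext_tmul fun φ ψ => ?_
    rw [innerSL_apply_apply, ← ContinuousLinearMap.adjoint_inner_right, adjoint_tensorOp,
      tensorOp_tmul]
    exact key _ (hA.adjoint_apply_mem_closure φ) _ (hB.adjoint_apply_mem_closure ψ)

end Tensor

/-! ### Traces and independence of the basis. -/

theorem _root_.HilbertBasis.summable_norm_inner_mul_inner {κ H : Type*}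
    [NormedAddCommGroup H] [InnerProductSpace ℂ H] (b : HilbertBasis κ ℂ H) (x y : H) :
    Summable (fun k => ‖⟪x, b k⟫_ℂ * ⟪b k, y⟫_ℂ‖) ∧
      ∑' k, ‖⟪x, b k⟫_ℂ * ⟪b k, y⟫_ℂ‖ ≤ ‖x‖ * ‖y‖ := by
  have hsq : ∀ z : H, HasSum (fun k => ‖⟪b k, z⟫_ℂ‖ ^ (2 : ℝ)) (‖z‖ ^ (2 : ℝ)) := fun z => by
    have h := b.hasSum_inner_mul_inner z z
    rw [inner_self_eq_norm_sq_to_K] at h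
    have h2 : ∀ k, ⟪z, b k⟫_ℂ * ⟪b k, z⟫_ℂ = ((‖⟪b k, z⟫_ℂ‖ ^ 2 : ℝ) : ℂ) := fun k => by
      rw [← inner_conj_symm, mul_comm, RCLike.mul_conj]
      push_cast
      rfl
    simp only [h2] at h
    simp only [Real.rpow_two]
    exact Complex.hasSum_ofReal.1 (by simpa using h)
  have h := Real.summable_and_inner_le_Lp_mul_Lq_tsum_of_nonneg Real.HolderConjugate.two_two
    (fun k => norm_nonneg ⟪b k, x⟫_ℂ) (fun k => norm_nonneg ⟪b k, y⟫_ℂ)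
    (hsq x).summable (hsq y).summable
  rw [(hsq x).tsum_eq, (hsq y).tsum_eq, one_div, Real.rpow_rpow_inv (norm_nonneg _) two_ne_zero,
    Real.rpow_rpow_inv (norm_nonneg _) two_ne_zero] at h
  simpa only [norm_mul, norm_inner_symm x] using h

section Trace

variable {H : Type*} [NormedAddCommGroup H] [InnerProductSpace ℂ H] [CompleteSpace H]

namespace IsSingularSystem

variable {ι : Type*} {A : H →L[ℂ] H} {u : ι → H} {s : ι → ℝ}

theorem norm_apply (h : IsSingularSystem A u s) (i : ι) : ‖A (u i)‖ = s i := by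
  have h1 : ⟪A (u i), A (u i)⟫_ℂ = ((s i ^ 2 : ℝ) : ℂ) := by
    rw [← ContinuousLinearMap.adjoint_inner_right, h.adjoint_apply, inner_smul_right,
      inner_self_eq_norm_sq_to_K, h.orthonormal.1]
    simp
  rw [inner_self_eq_norm_sq_to_K] at h1
  rw [← sq_eq_sq₀ (norm_nonneg _) (h.pos i).le]
  exact Complex.ofReal_injective (by simpa using h1)

theorem summable_inner (h : IsSingularSystem A u s) (hs : Summable s) :
    Summable fun i => ‖⟪u i, A (u i)⟫_ℂ‖ :=
  hs.of_nonneg_of_le (fun _ => norm_nonneg _) fun i =>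
    (norm_inner_le_norm _ _).trans (by rw [h.orthonormal.1, h.norm_apply, one_mul])

/-- The expansion `A x = ∑ i, ⟪u i, x⟫ A (u i)`. -/
theorem hasSum_apply (h : IsSingularSystem A u s) (x : H) :
    HasSum (fun i => ⟪u i, x⟫_ℂ • A (u i)) (A x) := by
  -- The vectors added to complete `u` to a Hilbert basis are killed by `A`.
  obtain ⟨w, b, huw, hb⟩ := h.orthonormal.toSubtypeRange.exists_hilbertBasis_extension
  let j : ι → w := fun i => ⟨u i, huw ⟨i, rfl⟩⟩
  have hj : Function.Injective j := fun i i' hii =>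
    h.orthonormal.linearIndependent.injective (congrArg Subtype.val hii)
  have hbj : ∀ i, b (j i) = u i := fun i => congrFun hb (j i)
  have hsum : HasSum (fun k => ⟪b k, x⟫_ℂ • A (b k)) (A x) := by
    simpa [b.repr_apply_apply] using (b.hasSum_repr x).mapL A
  rw [← hj.hasSum_iff] at hsum
  · simpa [Function.comp_def, hbj] using hsum
  · intro k hk
    rw [h.apply_eq_zero (b k) fun i => ?_, smul_zero]
    rw [← hbj]
    exact b.orthonormal.2 fun hik => hk ⟨i, hik⟩

end IsSingularSystem

/-- The trace of an operator with summable singular values, computed in a singular system. -/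
theorem IsSingularSystem.hasTrace {ι : Type*} {A : H →L[ℂ] H} {u : ι → H} {s : ι → ℝ}
    (h : IsSingularSystem A u s) (hs : Summable s) :
    HasTrace A (∑' i, ⟪u i, A (u i)⟫_ℂ) := by
  intro σ b
  have hb := fun i => b.summable_norm_inner_mul_inner (u i) (A (u i))
  -- By Cauchy–Schwarz the row sums of norms are at most `‖u i‖ * ‖A (u i)‖ = s i`. Summing over the
  -- basis first gives `⟪u i, A (u i)⟫`; summing over `i` first gives `⟪b k, A (b k)⟫`.
  have hsum : Summable fun n : ι × σ => ⟪u n.1, b n.2⟫_ℂ * ⟪b n.2, A (u n.1)⟫_ℂ := by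
    refine Summable.of_norm ((summable_prod_of_nonneg fun _ => norm_nonneg _).2
      ⟨fun i => (hb i).1, ?_⟩)
    refine hs.of_nonneg_of_le (fun _ => tsum_nonneg fun _ => norm_nonneg _) fun i => ?_
    refine (hb i).2.trans ?_
    rw [h.orthonormal.1, h.norm_apply, one_mul]
  have h1 := hsum.hasSum.prod_fiberwise fun i => b.hasSum_inner_mul_inner (u i) (A (u i))
  rw [h1.tsum_eq]
  refine ((Equiv.prodComm σ ι).hasSum_iff.2 hsum.hasSum).prod_fiberwise fun k => ?_
  have h2 := (h.hasSum_apply (b k)).mapL (innerSL ℂ (b k))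
  simpa [inner_smul_right] using h2

theorem HasTrace.trace_eq {A : H →L[ℂ] H} {t : ℂ} (h : HasTrace A t) : trace A = t :=
  (h _ _).tsum_eq

end Trace

/-- Lets Schatten sums be evaluated in any singular system, in particular the product one. -/
theorem memSchatten_iff {H ι : Type*} [NormedAddCommGroup H] [InnerProductSpace ℂ H]
    [CompleteSpace H] {A : H →L[ℂ] H} (hA : IsCompactOperator A) {u : ι → H} {s : ι → ℝ}
    (h : IsSingularSystem A u s) (p : ℝ) :
    (MemSchatten p A ↔ Summable fun i => s i ^ p) ∧
      schattenNorm p A = (∑' i, s i ^ p) ^ (1 / p) := by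
  obtain ⟨e, he⟩ := h.exists_equiv_singularIndex hA
  have hfun : (fun i => s i ^ p) = (fun n => singularValue A n ^ p) ∘ e :=
    funext fun i => by simp [he]
  rw [MemSchatten, schattenNorm, hfun, e.summable_iff]
  exact ⟨and_iff_right hA, by rw [← e.tsum_eq]; rfl⟩

end SchattenTensor

end

theorem mainTheorem3 {H₁ : Type*} {H₂ : Type*}
    [NormedAddCommGroup H₁] [InnerProductSpace ℂ H₁] [CompleteSpace H₁]
    [TopologicalSpace.SeparableSpace H₁]
    [NormedAddCommGroup H₂] [InnerProductSpace ℂ H₂] [CompleteSpace H₂]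
    [TopologicalSpace.SeparableSpace H₂]
    (A : H₁ →L[ℂ] H₁) (B : H₂ →L[ℂ] H₂) :
    (IsCompactOperator A → IsCompactOperator B →
      IsCompactOperator (SchattenTensor.tensorOp A B)) ∧
    (∀ p : ℝ, 0 < p → SchattenTensor.MemSchatten p A → SchattenTensor.MemSchatten p B →
      SchattenTensor.MemSchatten p (SchattenTensor.tensorOp A B) ∧
      SchattenTensor.schattenNorm p (SchattenTensor.tensorOp A B) =
        SchattenTensor.schattenNorm p A * SchattenTensor.schattenNorm p B) ∧
    (SchattenTensor.MemSchatten 1 A → SchattenTensor.MemSchatten 1 B →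
      SchattenTensor.HasTrace A (SchattenTensor.trace A) ∧
      SchattenTensor.HasTrace B (SchattenTensor.trace B) ∧
      SchattenTensor.HasTrace (SchattenTensor.tensorOp A B)
        (SchattenTensor.trace (SchattenTensor.tensorOp A B)) ∧
      SchattenTensor.trace (SchattenTensor.tensorOp A B) =
        SchattenTensor.trace A * SchattenTensor.trace B) := by

  open SchattenTensor in
  refine ⟨isCompactOperator_tensorOp, fun p _ hA hB => ?_, fun hA hB => ?_⟩
  · obtain ⟨u, hu⟩ := exists_isSingularSystem hA.1
    obtain ⟨v, hv⟩ := exists_isSingularSystem hB.1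
    obtain ⟨hmem, hnorm⟩ :=
      memSchatten_iff (isCompactOperator_tensorOp hA.1 hB.1) (hu.tensorOp hv) p
    have hmul : (fun n : SingularIndex A × SingularIndex B =>
        (singularValue A n.1 * singularValue B n.2) ^ p) =
        fun n => singularValue A n.1 ^ p * singularValue B n.2 ^ p :=
      funext fun n => Real.mul_rpow (hu.pos n.1).le (hv.pos n.2).le
    have hA0 : ∀ n, 0 ≤ singularValue A n ^ p := fun n => Real.rpow_nonneg (hu.pos n).le p
    have hB0 : ∀ n, 0 ≤ singularValue B n ^ p := fun n => Real.rpow_nonneg (hv.pos n).le p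
    have hsum := hA.2.mul_of_nonneg hB.2 hA0 hB0
    rw [hmul] at hmem hnorm
    refine ⟨hmem.2 hsum, ?_⟩
    rw [hnorm, schattenNorm, schattenNorm,
      ← Real.mul_rpow (tsum_nonneg hA0) (tsum_nonneg hB0), hA.2.tsum_mul_tsum hB.2 hsum]
  · obtain ⟨u, hu⟩ := exists_isSingularSystem hA.1
    obtain ⟨v, hv⟩ := exists_isSingularSystem hB.1
    have hsA : Summable (singularValue A) := by simpa using hA.2
    have hsB : Summable (singularValue B) := by simpa using hB.2
    have hs := hsA.mul_of_nonneg hsB (fun n => (hu.pos n).le) (fun n => (hv.pos n).le)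
    have tA := hu.hasTrace hsA
    have tB := hv.hasTrace hsB
    have tAB := (hu.tensorOp hv).hasTrace hs
    rw [tA.trace_eq, tB.trace_eq, tAB.trace_eq]
    refine ⟨tA, tB, tAB, ?_⟩
    have huA := hu.summable_inner hsA
    have hvB := hv.summable_inner hsB
    rw [tsum_mul_tsum_of_summable_norm huA hvB]
    simp only [tensorOp_tmul, inner_tmul]
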